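/- Let $k \ge 0$ be an integer and let $G$ be a finite simple graph of order $n \ge k$ that is $k$-degenerate, i.e. every (nonempty) subgraph of $G$ contains a vertex of degree at most $k$ in that subgraph. For a finite graph $H$, let $q(H)$ denote the largest eigenvalue of its signless Laplacian $Q(H) = D(H) + A(H)$, where $D(H)$ is the diagonal matrix of vertex degrees and $A(H)$ is the adjacency matrix. Let $S_{n,k}$ be the join of a complete graph of order $k$ and an independent set of order $n-k$. Then $$q(G) < q(S_{n,k}),$$ unless $G$ is isomorphic to $S_{n,k}$. -/

import Mathlib

/-- A graph is `k`-degenerate if every (nonempty, not necessarily induced) subgraph has a vertex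
whose degree in that subgraph is at most `k`. -/
def SimpleGraph.IsDegenerate {V : Type*} (G : SimpleGraph V) (k : ℕ) : Prop :=
  ∀ H : G.Subgraph, H.verts.Nonempty → ∃ v ∈ H.verts, (H.neighborSet v).encard ≤ k

/-- The join of two graphs: their disjoint union together with all edges between the two parts. -/
def SimpleGraph.joinGraph {V W : Type*} (G : SimpleGraph V) (H : SimpleGraph W) :
    SimpleGraph (V ⊕ W) :=
  G.sum H ⊔ completeBipartiteGraph V W

/-- `S_{n,k}`: the join of a complete graph of order `k` and an independent set of order `n - k`
(used only for `k ≤ n`, so that its order is `n`). -/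
def graphS (n k : ℕ) : SimpleGraph (Fin k ⊕ Fin (n - k)) :=
  (⊤ : SimpleGraph (Fin k)).joinGraph (⊥ : SimpleGraph (Fin (n - k)))

open Classical in
/-- The signless Laplacian `Q = D + A`. -/
noncomputable def SimpleGraph.signlessLaplacian {V : Type*} [Fintype V] (G : SimpleGraph V) :
    Matrix V V ℝ :=
  G.degMatrix ℝ + G.adjMatrix ℝ

open Classical in
/-- The largest eigenvalue `q(G)` of the signless Laplacian. -/
noncomputable def SimpleGraph.qIndex {V : Type*} [Fintype V] (G : SimpleGraph V) : ℝ :=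
  sSup (spectrum ℝ G.signlessLaplacian)

open Classical in
/-- For a nonempty graph, `q(G)` is indeed the largest eigenvalue of the signless Laplacian. -/
theorem SimpleGraph.isGreatest_qIndex {V : Type*} [Fintype V] [Nonempty V] (G : SimpleGraph V) :
    IsGreatest {x : ℝ | Module.End.HasEigenvalue (Matrix.toLin' G.signlessLaplacian) x}
      G.qIndex := by
  have hH : G.signlessLaplacian.IsHermitian :=
    (G.isHermitian_degMatrix ℝ).add (G.isHermitian_adjMatrix ℝ)
  have hset : {x : ℝ | Module.End.HasEigenvalue (Matrix.toLin' G.signlessLaplacian) x} =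
      spectrum ℝ G.signlessLaplacian := by
    ext x
    rw [Set.mem_ofPred_eq, Module.End.hasEigenvalue_iff_mem_spectrum, Matrix.spectrum_toLin']
  have hfin : (spectrum ℝ G.signlessLaplacian).Finite := by
    rw [hH.spectrum_real_eq_range_eigenvalues]
    exact Set.finite_range _
  have hne : (spectrum ℝ G.signlessLaplacian).Nonempty := by
    rw [hH.spectrum_real_eq_range_eigenvalues]
    exact Set.range_nonempty _
  rw [hset]
  exact ⟨hne.csSup_mem hfin, fun x hx => le_csSup hfin.bddAbove hx⟩

/-! For `1 ≤ k < n` let `r > s` be the roots of `x² - (n+2k-2)x + 2k(k-1)`. Since `r` is an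
eigenvalue of `S_{n,k}`, it suffices that every eigenvalue of `G` is less than `r`. Enlarge `G` to a
`k`-degenerate `H` of minimum degree at least `k` and weight each vertex by `w = 2 d_H - s > 0`; on
`S_{n,k}` this is an eigenvector for `r`. By `signlessLaplacian_mulVec_degree`, the defect `r w -
Q(H) w` is a sum of three nonnegative terms: the shortfall from the maximal edge count, the excess
degrees of the non-neighbours, and `(d-k)(n-1-d)`. Hence `Q(G) w ≤ Q(H) w ≤ r w`, and comparison
with a positive vector bounds the eigenvalues by `r`.

If `r` were reached, `exists_closed_of_mulVec_le` gives equality on a set closed under adjacency in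
`G`. There all three terms vanish, which yields a dominating vertex, so the set is everything, `G =
H`, and the degrees force `G = S_{n,k}`. -/

/-! ### The signless Laplacian on positive vectors -/

open Classical in
theorem SimpleGraph.signlessLaplacian_mulVec {V : Type*} [Fintype V] (G : SimpleGraph V)
    (w : V → ℝ) (v : V) :
    (G.signlessLaplacian.mulVec w) v = ∑ u, if G.Adj v u then w v + w u else 0 := by
  rw [SimpleGraph.signlessLaplacian, Matrix.add_mulVec, Pi.add_apply,
    SimpleGraph.degMatrix_mulVec_apply, SimpleGraph.adjMatrix_mulVec_apply,
    ← Finset.sum_filter, Finset.sum_add_distrib, Finset.sum_const, nsmul_eq_mul,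
    ← SimpleGraph.neighborFinset_eq_filter, SimpleGraph.card_neighborFinset_eq_degree]

open Classical in
theorem SimpleGraph.signlessLaplacian_mulVec_mono {V : Type*} [Fintype V] {G H : SimpleGraph V}
    (hGH : G ≤ H) {w : V → ℝ} (hw : ∀ v, 0 < w v) (v : V) :
    (G.signlessLaplacian.mulVec w) v ≤ (H.signlessLaplacian.mulVec w) v := by
  rw [G.signlessLaplacian_mulVec, H.signlessLaplacian_mulVec]
  refine Finset.sum_le_sum fun u _ => ?_
  have := hw v
  have := hw u
  by_cases h : G.Adj v u
  · simp [h, hGH h]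
  · simp only [h, if_false]
    split_ifs <;> linarith

open Classical in
theorem SimpleGraph.adj_of_signlessLaplacian_mulVec_eq {V : Type*} [Fintype V]
    {G H : SimpleGraph V} (hGH : G ≤ H) {w : V → ℝ} (hw : ∀ v, 0 < w v) {v : V}
    (h : (G.signlessLaplacian.mulVec w) v = (H.signlessLaplacian.mulVec w) v) {u : V}
    (hu : H.Adj v u) : G.Adj v u := by
  by_contra hG
  rw [G.signlessLaplacian_mulVec, H.signlessLaplacian_mulVec] at h
  refine h.not_lt (Finset.sum_lt_sum (fun x _ => ?_) ⟨u, Finset.mem_univ _, ?_⟩)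
  · have := hw v
    have := hw x
    by_cases h : G.Adj v x
    · simp [h, hGH h]
    · simp only [h, if_false]
      split_ifs <;> linarith
  · simp only [hG, hu, if_false, if_true]
    exact add_pos (hw v) (hw u)

/-- If a positive vector `w` satisfies `Q w ≤ r w` and `q ≥ r` is an eigenvalue of `Q`, then
equality holds on a nonempty set of vertices that is closed under adjacency. -/
theorem SimpleGraph.exists_closed_of_mulVec_le {V : Type*} [Fintype V] (G : SimpleGraph V)
    {w y : V → ℝ} {r q : ℝ} (hw : ∀ v, 0 < w v)
    (hr : ∀ v, (G.signlessLaplacian.mulVec w) v ≤ r * w v) (hy : y ≠ 0)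
    (hq : ∀ v, (G.signlessLaplacian.mulVec y) v = q * y v) (hrq : r ≤ q) :
    ∃ A : Set V, A.Nonempty ∧ ∀ i ∈ A, (G.signlessLaplacian.mulVec w) i = r * w i ∧
      ∀ j, G.Adj i j → j ∈ A := by
  classical
  obtain ⟨z, hz⟩ := Function.ne_iff.mp hy
  obtain ⟨m, -, hm⟩ := Finset.exists_max_image Finset.univ (fun v => |y v| / w v)
    ⟨z, Finset.mem_univ z⟩
  -- `t` is the largest ratio `|y| / w`; the set sought consists of the vertices attaining it.
  set t := |y m| / w m with ht
  have hle : ∀ v, |y v| ≤ t * w v := fun v =>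
    (div_le_iff₀ (hw v)).mp (hm v (Finset.mem_univ v))
  have htpos : 0 < t := by
    have h1 : 0 < |y z| := abs_pos.mpr hz
    have h2 := hle z
    by_contra hcon
    have := mul_nonpos_of_nonpos_of_nonneg (not_lt.mp hcon) (hw z).le
    linarith
  refine ⟨{v | |y v| = t * w v}, ⟨m, ?_⟩, ?_⟩
  · exact (div_mul_cancel₀ _ (hw m).ne').symm
  intro i hi
  have hi' : |y i| = t * w i := hi
  -- The chain `q|y i| ≤ B ≤ t (Q w) i ≤ t r w i ≤ q|y i|` collapses to equalities; termwise
  -- equality in the second link puts the neighbours of `i` in the set.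
  set B := ∑ u, if G.Adj i u then |y i| + |y u| else 0 with hB
  have h1 : q * |y i| ≤ B := by
    calc q * |y i| ≤ |q * y i| := by
          rw [abs_mul]; exact mul_le_mul_of_nonneg_right (le_abs_self q) (abs_nonneg _)
      _ = |∑ u, if G.Adj i u then y i + y u else 0| := by
          rw [← hq i, G.signlessLaplacian_mulVec]
      _ ≤ ∑ u, |if G.Adj i u then y i + y u else 0| := Finset.abs_sum_le_sum_abs _ _
      _ ≤ B := by
          refine Finset.sum_le_sum fun u _ => ?_
          split_ifs
          · exact abs_add_le _ _
          · simp
  have hterm : ∀ u ∈ Finset.univ, (if G.Adj i u then |y i| + |y u| else 0) ≤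
      t * (if G.Adj i u then w i + w u else 0) := by
    intro u _
    have := hle u
    split_ifs <;> linarith
  have h2 : B ≤ t * (G.signlessLaplacian.mulVec w) i := by
    rw [G.signlessLaplacian_mulVec, Finset.mul_sum]
    exact Finset.sum_le_sum hterm
  have h3 : t * (G.signlessLaplacian.mulVec w) i ≤ t * (r * w i) :=
    mul_le_mul_of_nonneg_left (hr i) htpos.le
  have h4 : t * (r * w i) ≤ q * |y i| := by
    rw [hi', show t * (r * w i) = r * (t * w i) by ring]
    exact mul_le_mul_of_nonneg_right hrq (mul_pos htpos (hw i)).le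
  refine ⟨mul_left_cancel₀ htpos.ne' (le_antisymm h3 (by linarith)), fun j hj => ?_⟩
  have h5 : B = t * (G.signlessLaplacian.mulVec w) i := le_antisymm h2 (by linarith)
  rw [G.signlessLaplacian_mulVec, Finset.mul_sum, hB,
    Finset.sum_eq_sum_iff_of_le hterm] at h5
  have h6 := h5 j (Finset.mem_univ j)
  simp only [hj, if_true] at h6
  change |y j| = t * w j
  linarith

/-! ### Degenerate graphs: edge count and extension -/

open Classical in
/-- Degeneracy in terms of induced subgraphs on finite sets of vertices. -/
def SimpleGraph.IsFinsetDegenerate {V : Type*} (G : SimpleGraph V) (k : ℕ) : Prop :=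
  ∀ S : Finset V, S.Nonempty → ∃ v ∈ S, (S.filter (G.Adj v)).card ≤ k

theorem SimpleGraph.IsDegenerate.isFinsetDegenerate {V : Type*} {G : SimpleGraph V} {k : ℕ}
    (hG : G.IsDegenerate k) : G.IsFinsetDegenerate k := by
  classical
  intro S hS
  obtain ⟨v, hv, h⟩ := hG ((⊤ : G.Subgraph).induce (S : Set V)) hS
  refine ⟨v, hv, ?_⟩
  have hset : ((⊤ : G.Subgraph).induce (S : Set V)).neighborSet v =
      ((S.filter (G.Adj v) : Finset V) : Set V) := by
    ext u
    have hv' : v ∈ S := hv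
    simp [SimpleGraph.Subgraph.mem_neighborSet, hv']
  rw [hset, Set.encard_coe_eq_coe_finsetCard] at h
  exact_mod_cast h

-- Deleting vertices of degree at most `k` until `k` vertices remain loses at most `2k` ordered
-- adjacent pairs each time, and the remaining core has at most `k(k-1)`.
open Classical in
theorem SimpleGraph.IsFinsetDegenerate.sum_adj_le {V : Type*} {G : SimpleGraph V} {k : ℕ}
    (hG : G.IsFinsetDegenerate k) (m : ℕ) : ∀ S : Finset V, S.card = k + m →
      (∑ a ∈ S, ∑ b ∈ S, if G.Adj a b then 1 else 0) + k * (k + 1) ≤ 2 * k * S.card := by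
  induction m with
  | zero =>
    intro S hS
    have h : ∀ a ∈ S, (∑ b ∈ S, if G.Adj a b then 1 else 0) ≤ k - 1 := by
      intro a ha
      rw [← Finset.card_filter, ← show S.card = k from hS, ← Finset.card_erase_of_mem ha]
      refine Finset.card_le_card fun b hb => ?_
      rw [Finset.mem_filter] at hb
      exact Finset.mem_erase.mpr ⟨hb.2.ne', hb.1⟩
    have h2 := Finset.sum_le_card_nsmul S _ _ h
    rw [hS, smul_eq_mul] at h2
    rw [hS]
    -- The bound `k - 1` is a truncated subtraction, hence the separate case `k = 0`.
    rcases k with _ | k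
    · simpa using h2
    · simp only [Nat.add_sub_cancel, add_zero] at h2 ⊢
      nlinarith
  | succ m ih =>
    intro S hS
    obtain ⟨v, hv, hd⟩ := hG S (Finset.card_pos.mp (by omega))
    have hc : (S.erase v).card = k + m := by rw [Finset.card_erase_of_mem hv]; omega
    have h := ih (S.erase v) hc
    have h1 : ∀ f : V → ℕ, ∑ a ∈ S, f a = f v + ∑ a ∈ S.erase v, f a := fun f =>
      (Finset.add_sum_erase S f hv).symm
    have h2 : (∑ b ∈ S.erase v, if G.Adj v b then 1 else 0) ≤ k := by
      rw [Finset.card_filter, h1] at hd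
      omega
    have h3 : (∑ a ∈ S, ∑ b ∈ S, if G.Adj a b then 1 else 0) =
        2 * (∑ b ∈ S.erase v, if G.Adj v b then 1 else 0) +
          ∑ a ∈ S.erase v, ∑ b ∈ S.erase v, if G.Adj a b then 1 else 0 := by
      rw [h1]
      simp_rw [h1 (fun b => if G.Adj _ b then 1 else 0)]
      rw [Finset.sum_add_distrib]
      simp only [G.loopless.irrefl v, if_false]
      simp_rw [G.adj_comm _ v]
      ring
    rw [h3, hS]
    rw [hc] at h
    nlinarith

open Classical in
theorem SimpleGraph.IsFinsetDegenerate.sum_degree_le {V : Type*} [Fintype V] {G : SimpleGraph V}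
    {k : ℕ} (hG : G.IsFinsetDegenerate k) (hk : k ≤ Fintype.card V) :
    (∑ v, (G.degree v : ℝ)) ≤ 2 * k * Fintype.card V - k * (k + 1) := by
  have h := hG.sum_adj_le (Fintype.card V - k) Finset.univ (by rw [Finset.card_univ]; omega)
  have h2 : (∑ a : V, ∑ b : V, if G.Adj a b then 1 else 0) = ∑ v, G.degree v := by
    refine Finset.sum_congr rfl fun v _ => ?_
    rw [← Finset.card_filter, ← SimpleGraph.neighborFinset_eq_filter,
      SimpleGraph.card_neighborFinset_eq_degree]
  rw [h2, Finset.card_univ] at h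
  have h3 : ((∑ v, G.degree v : ℕ) : ℝ) + k * (k + 1) ≤ 2 * k * Fintype.card V := by
    exact_mod_cast h
  push_cast at h3
  linarith

open Classical in
/-- A degenerate graph extends to a degenerate graph of minimum degree at least `k`. -/
theorem SimpleGraph.IsFinsetDegenerate.exists_ge_minDegree {V : Type*} [Fintype V]
    {G : SimpleGraph V} {k : ℕ} (hG : G.IsFinsetDegenerate k) (hk : k < Fintype.card V) :
    ∃ H : SimpleGraph V, G ≤ H ∧ H.IsFinsetDegenerate k ∧ ∀ v, k ≤ H.degree v := by
  obtain ⟨H, hGH, hH⟩ :=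
    (Set.toFinite {H : SimpleGraph V | H.IsFinsetDegenerate k}).exists_le_maximal hG
  refine ⟨H, hGH, hH.prop, fun v => ?_⟩
  by_contra! hv
  obtain ⟨u, huv, hu⟩ : ∃ u, u ≠ v ∧ ¬ H.Adj v u := by
    by_contra! hcon
    have : Finset.univ.erase v ⊆ H.neighborFinset v := fun u hu => by
      simpa using hcon u (Finset.ne_of_mem_erase hu)
    have h := Finset.card_le_card this
    rw [Finset.card_erase_of_mem (Finset.mem_univ v), Finset.card_univ,
      SimpleGraph.card_neighborFinset_eq_degree] at h
    omega
  obtain ⟨H', hHH', hvu, hadj⟩ : ∃ H' : SimpleGraph V, H ≤ H' ∧ H'.Adj v u ∧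
      ∀ a b, H'.Adj a b → H.Adj a b ∨ (a = v ∧ b = u) ∨ (a = u ∧ b = v) := by
    refine ⟨H ⊔ SimpleGraph.edge v u, le_sup_left, ?_, fun a b hab => ?_⟩
    · rw [SimpleGraph.sup_adj, SimpleGraph.edge_adj]; tauto
    · rw [SimpleGraph.sup_adj, SimpleGraph.edge_adj] at hab; tauto
  -- In a set containing `v`, the vertex `v` itself works, its degree having risen to at most `k`;
  -- other sets do not see the new edge.
  have hdeg : H'.IsFinsetDegenerate k := by
    intro S hS
    by_cases hvS : v ∈ S
    · refine ⟨v, hvS, ?_⟩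
      have h := Finset.card_insert_le u (H.neighborFinset v)
      rw [SimpleGraph.card_neighborFinset_eq_degree] at h
      refine (Finset.card_le_card fun b hb => ?_).trans (h.trans hv)
      rcases hadj v b (Finset.mem_filter.mp hb).2 with h | h | h
      · exact Finset.mem_insert_of_mem (by simpa using h)
      · rw [h.2]; exact Finset.mem_insert_self _ _
      · exact absurd h.1.symm huv
    · obtain ⟨a, ha, hd⟩ := hH.prop S hS
      refine ⟨a, ha, (Finset.card_le_card fun b hb => ?_).trans hd⟩
      replace hb := Finset.mem_filter.mp hb
      refine Finset.mem_filter.mpr ⟨hb.1, ?_⟩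
      rcases hadj a b hb.2 with h | h | h
      · exact h
      · exact absurd (h.1 ▸ ha) hvS
      · exact absurd (h.2 ▸ hb.1) hvS
  exact hu (hH.le_of_ge hdeg hHH' hvu)

/-! ### The test vector `2 d - s` -/

open Classical in
theorem SimpleGraph.sum_degree_adj {V : Type*} [Fintype V] (G : SimpleGraph V) (v : V)
    (f : V → ℝ) :
    (∑ u, if G.Adj v u then f u else 0) =
      ∑ u, f u - f v - ∑ u, if u ≠ v ∧ ¬ G.Adj v u then f u else 0 := by
  have h : f v = ∑ u, if u = v then f u else 0 := by simp
  rw [h, ← Finset.sum_sub_distrib, ← Finset.sum_sub_distrib]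
  refine Finset.sum_congr rfl fun u _ => ?_
  by_cases h1 : u = v
  · subst h1; simp
  · by_cases h2 : G.Adj v u <;> simp [h1, h2]

open Classical in
/-- The defect of the vector `2 d - s` in the inequality `Q w ≤ r w`. -/
theorem SimpleGraph.signlessLaplacian_mulVec_degree {V : Type*} [Fintype V] (G : SimpleGraph V)
    {k r s : ℝ} (hsum : r + s = Fintype.card V + 2 * k - 2) (hprod : r * s = 2 * k * (k - 1))
    (v : V) :
    r * (2 * G.degree v - s) -
        (G.signlessLaplacian.mulVec fun u => 2 * (G.degree u : ℝ) - s) v =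
      2 * (2 * k * Fintype.card V - k * (k + 1) - ∑ u, (G.degree u : ℝ)) +
      2 * (∑ u, if u ≠ v ∧ ¬ G.Adj v u then (G.degree u : ℝ) - k else 0) +
      2 * ((G.degree v - k) * (Fintype.card V - 1 - G.degree v)) := by
  have hone : (∑ u, if G.Adj v u then (1 : ℝ) else 0) = G.degree v := by
    rw [Finset.sum_boole, ← SimpleGraph.neighborFinset_eq_filter,
      SimpleGraph.card_neighborFinset_eq_degree]
  have h1 := G.sum_degree_adj v fun u => (G.degree u : ℝ) - k
  have h2 : (∑ u, if G.Adj v u then (G.degree u : ℝ) - k else 0) =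
      (∑ u, if G.Adj v u then (G.degree u : ℝ) else 0) - k * G.degree v := by
    rw [← hone, Finset.mul_sum, ← Finset.sum_sub_distrib]
    exact Finset.sum_congr rfl fun u _ => by split_ifs <;> ring
  have h3 : (G.signlessLaplacian.mulVec fun u => 2 * (G.degree u : ℝ) - s) v =
      2 * (∑ u, if G.Adj v u then (G.degree u : ℝ) else 0) +
        (2 * G.degree v - 2 * s) * G.degree v := by
    rw [G.signlessLaplacian_mulVec]
    rw [show (2 * (G.degree v : ℝ) - 2 * s) * G.degree v = (2 * (G.degree v : ℝ) - 2 * s) *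
      ∑ u, if G.Adj v u then (1 : ℝ) else 0 by rw [hone], Finset.mul_sum, Finset.mul_sum, ← Finset.sum_add_distrib]
    exact Finset.sum_congr rfl fun u _ => by split_ifs <;> ring
  have h4 : (∑ u : V, ((G.degree u : ℝ) - k)) =
      (∑ u, (G.degree u : ℝ)) - Fintype.card V * k := by
    rw [Finset.sum_sub_distrib, Finset.sum_const, Finset.card_univ, nsmul_eq_mul]
  rw [h2, h4] at h1
  rw [h3]
  have h5 : (∑ u, if G.Adj v u then (G.degree u : ℝ) else 0) = k * G.degree v +
    ((∑ u, (G.degree u : ℝ)) - Fintype.card V * k - (G.degree v - k) -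
      ∑ u, if u ≠ v ∧ ¬ G.Adj v u then (G.degree u : ℝ) - k else 0) := by linarith
  rw [h5]
  linear_combination (2 * (G.degree v : ℝ)) * hsum - hprod

/-! ### Recognizing complete split graphs -/

/-- `G` is the join of a clique on `k` vertices and an independent set. -/
def SimpleGraph.IsCompleteSplit {V : Type*} (G : SimpleGraph V) (k : ℕ) : Prop :=
  ∃ K : Finset V, K.card = k ∧ ∀ u v, G.Adj u v ↔ u ≠ v ∧ (u ∈ K ∨ v ∈ K)

theorem SimpleGraph.IsCompleteSplit.nonempty_iso {V : Type*} [Fintype V] {G : SimpleGraph V}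
    {k n : ℕ} (hG : G.IsCompleteSplit k) (hn : Fintype.card V = n) :
    Nonempty (G ≃g graphS n k) := by
  classical
  obtain ⟨K, hK, hadj⟩ := hG
  have e1 : {v // v ∈ K} ≃ Fin k := Fintype.equivFinOfCardEq (by simpa using hK)
  have e2 : {v // ¬ v ∈ K} ≃ Fin (n - k) := Fintype.equivFinOfCardEq (by
    rw [Fintype.card_subtype_compl, hn]; simp [hK])
  refine ⟨⟨(Equiv.sumCompl (· ∈ K)).symm.trans (Equiv.sumCongr e1 e2), fun {a b} => ?_⟩⟩
  rw [hadj]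
  by_cases ha : a ∈ K <;> by_cases hb : b ∈ K <;>
    simp [graphS, SimpleGraph.joinGraph, ha, hb, Equiv.sumCompl_symm_apply_of_pos,
      Equiv.sumCompl_symm_apply_of_neg]
  · rintro rfl; exact hb ha
  · rintro rfl; exact ha hb

/-- With at most `k + 1` vertices the independent part has at most one vertex, so completeness is
enough. -/
theorem SimpleGraph.IsCompleteSplit.of_forall_adj {V : Type*} [Fintype V] {G : SimpleGraph V}
    {k : ℕ} (hk : k ≤ Fintype.card V) (hk' : Fintype.card V ≤ k + 1)
    (h : ∀ u v, u ≠ v → G.Adj u v) : G.IsCompleteSplit k := by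
  classical
  obtain ⟨K, -, hK⟩ := Finset.exists_subset_card_eq
    (show k ≤ (Finset.univ : Finset V).card by rwa [Finset.card_univ])
  refine ⟨K, hK, fun u v => ⟨fun huv => ⟨huv.ne, ?_⟩, fun huv => h u v huv.1⟩⟩
  by_contra! hcon
  have h1 : ({u, v} : Finset V) ⊆ Kᶜ := by
    intro a ha
    rw [Finset.mem_insert, Finset.mem_singleton] at ha
    rcases ha with rfl | rfl
    · simpa using hcon.1
    · simpa using hcon.2
  have h2 := Finset.card_le_card h1
  rw [Finset.card_pair huv.ne, Finset.card_compl, hK] at h2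
  omega

open Classical in
theorem SimpleGraph.adj_of_degree_eq {V : Type*} [Fintype V] {G : SimpleGraph V} {v : V}
    (h : (G.degree v : ℝ) = Fintype.card V - 1) {u : V} (huv : u ≠ v) : G.Adj v u := by
  have hd : G.degree v + 1 = Fintype.card V := by
    have : (G.degree v : ℝ) + 1 = Fintype.card V := by linarith
    exact_mod_cast this
  have hsub : insert v (G.neighborFinset v) = Finset.univ := by
    rw [← Finset.card_eq_iff_eq_univ, Finset.card_insert_of_notMem (by simp),
      SimpleGraph.card_neighborFinset_eq_degree, hd]
  have hu : u ∈ insert v (G.neighborFinset v) := hsub ▸ Finset.mem_univ u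
  simpa [huv] using hu

-- For `n > k + 1`, summing `d - k` shows that exactly `k` vertices are dominating; these already
-- exhaust the `k` neighbours of any other vertex. For `n = k + 1` the two allowed degrees coincide.
open Classical in
theorem SimpleGraph.isCompleteSplit_of_degree {V : Type*} [Fintype V] {G : SimpleGraph V}
    {k : ℕ} (hk : k < Fintype.card V)
    (hsum : (∑ v, (G.degree v : ℝ)) = 2 * k * Fintype.card V - k * (k + 1))
    (hdeg : ∀ v, (G.degree v : ℝ) = k ∨ (G.degree v : ℝ) = Fintype.card V - 1) :
    G.IsCompleteSplit k := by
  by_cases hn : Fintype.card V = k + 1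
  · refine .of_forall_adj hk.le hn.le fun u v huv => SimpleGraph.adj_of_degree_eq ?_ huv.symm
    rcases hdeg u with h | h
    · rw [h, hn]; push_cast; ring
    · exact h
  have hn' : (k : ℝ) + 1 < Fintype.card V := by
    have : k + 1 < Fintype.card V := by omega
    exact_mod_cast this
  set K := Finset.univ.filter fun v => (G.degree v : ℝ) = Fintype.card V - 1 with hKdef
  have hcard : K.card = k := by
    have h1 : (∑ v, ((G.degree v : ℝ) - k)) = K.card * (Fintype.card V - 1 - k) := by
      rw [← nsmul_eq_mul, ← Finset.sum_const, hKdef, Finset.sum_filter]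
      refine Finset.sum_congr rfl fun v _ => ?_
      split_ifs with h
      · rw [h]
      · rw [(hdeg v).resolve_right h, sub_self]
    rw [Finset.sum_sub_distrib, Finset.sum_const, Finset.card_univ, nsmul_eq_mul, hsum] at h1
    have h2 : ((K.card : ℝ) - k) * (Fintype.card V - 1 - k) = 0 := by linear_combination -h1
    rcases mul_eq_zero.mp h2 with h | h
    · exact_mod_cast sub_eq_zero.mp h
    · linarith
  have hdom : ∀ {u v}, u ∈ K → v ≠ u → G.Adj u v := fun hu huv =>
    SimpleGraph.adj_of_degree_eq (Finset.mem_filter.mp hu).2 huv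
  refine ⟨K, hcard, fun u v => ⟨fun huv => ⟨huv.ne, ?_⟩, ?_⟩⟩
  · by_contra! hcon
    have hu : (G.degree u : ℝ) = k := (hdeg u).resolve_right fun h =>
      hcon.1 (Finset.mem_filter.mpr ⟨Finset.mem_univ _, h⟩)
    have hsub : insert v K ⊆ G.neighborFinset u := by
      intro a ha
      rw [SimpleGraph.mem_neighborFinset]
      rcases Finset.mem_insert.mp ha with rfl | ha
      · exact huv
      · exact (hdom ha (ne_of_mem_of_not_mem ha hcon.1).symm).symm
    have h := Finset.card_le_card hsub
    rw [Finset.card_insert_of_notMem hcon.2, hcard, SimpleGraph.card_neighborFinset_eq_degree] at h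
    have : G.degree u = k := by exact_mod_cast hu
    omega
  · rintro ⟨hne, hu | hv⟩
    · exact hdom hu hne.symm
    · exact (hdom hv hne).symm

/-! ### The strict upper bound -/

open Classical in
/-- Every eigenvalue of a `k`-degenerate graph that is not complete split is less than the larger
root of `t ^ 2 - (n + 2 k - 2) t + 2 k (k - 1)`. -/
theorem SimpleGraph.IsFinsetDegenerate.eigenvalue_lt {V : Type*} [Fintype V] {G : SimpleGraph V}
    {k : ℕ} (hG : G.IsFinsetDegenerate k) (hkpos : 0 < k) (hk : k < Fintype.card V)
    (hS : ¬ G.IsCompleteSplit k)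
    {r s : ℝ} (hsum : r + s = Fintype.card V + 2 * k - 2)
    (hprod : r * s = 2 * k * (k - 1)) (hs : s < 2 * k) {q : ℝ} {y : V → ℝ} (hy : y ≠ 0)
    (hq : ∀ v, (G.signlessLaplacian.mulVec y) v = q * y v) : q < r := by
  by_contra! hrq
  obtain ⟨H, hGH, hH, hmin⟩ := hG.exists_ge_minDegree hk
  have hmin' : ∀ v, (k : ℝ) ≤ H.degree v := fun v => by exact_mod_cast hmin v
  have hmax : ∀ v, (H.degree v : ℝ) ≤ Fintype.card V - 1 := fun v => by
    have h := H.degree_lt_card_verts v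
    have : (H.degree v : ℝ) + 1 ≤ Fintype.card V := by exact_mod_cast h
    linarith
  have hE := hH.sum_degree_le hk.le
  set w : V → ℝ := fun u => 2 * (H.degree u : ℝ) - s with hwdef
  have hw : ∀ v, 0 < w v := fun v => by have := hmin' v; simp only [hwdef]; linarith
  have hterm : ∀ v, ∀ u ∈ Finset.univ,
      0 ≤ if u ≠ v ∧ ¬ H.Adj v u then (H.degree u : ℝ) - k else 0 := by
    intro v u _
    split_ifs
    · linarith [hmin' u]
    · exact le_rfl
  have hN := fun v => Finset.sum_nonneg (hterm v)
  have hD : ∀ v, 0 ≤ ((H.degree v : ℝ) - k) * (Fintype.card V - 1 - H.degree v) := fun v =>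
    mul_nonneg (by linarith [hmin' v]) (by linarith [hmax v])
  have hid := fun v => H.signlessLaplacian_mulVec_degree hsum hprod v
  have hle : ∀ v, (G.signlessLaplacian.mulVec w) v ≤ (H.signlessLaplacian.mulVec w) v :=
    SimpleGraph.signlessLaplacian_mulVec_mono hGH hw
  have hle' : ∀ v, (H.signlessLaplacian.mulVec w) v ≤ r * w v := fun v => by
    linarith [hid v, hN v, hD v]
  obtain ⟨A, ⟨a, ha⟩, hA⟩ := G.exists_closed_of_mulVec_le hw
    (fun v => (hle v).trans (hle' v)) hy hq hrq
  have hrow : ∀ i ∈ A, (G.signlessLaplacian.mulVec w) i = (H.signlessLaplacian.mulVec w) i :=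
    fun i hi => le_antisymm (hle i) ((hle' i).trans (hA i hi).1.ge)
  have hadj : ∀ i ∈ A, ∀ j, H.Adj i j → G.Adj i j := fun i hi j hij =>
    SimpleGraph.adj_of_signlessLaplacian_mulVec_eq hGH hw (hrow i hi) hij
  have heq : ∀ i ∈ A, r * w i = (H.signlessLaplacian.mulVec w) i := fun i hi =>
    (hA i hi).1.symm.trans (hrow i hi)
  have hT : (∑ v, (H.degree v : ℝ)) = 2 * k * Fintype.card V - k * (k + 1) := by
    linarith [hid a, hN a, hD a, heq a ha]
  have hdeg : ∀ i ∈ A, (H.degree i : ℝ) = k ∨ (H.degree i : ℝ) = Fintype.card V - 1 := by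
    intro i hi
    have h : ((H.degree i : ℝ) - k) * (Fintype.card V - 1 - H.degree i) = 0 :=
      le_antisymm (by linarith [hid i, hN i, hD i, heq i hi]) (hD i)
    rcases mul_eq_zero.mp h with h | h
    · left; linarith
    · right; linarith
  have hnon : ∀ i ∈ A, ∀ u, u ≠ i → ¬ H.Adj i u → (H.degree u : ℝ) = k := by
    intro i hi u hu hiu
    have h : (∑ u, if u ≠ i ∧ ¬ H.Adj i u then (H.degree u : ℝ) - k else 0) = 0 :=
      le_antisymm (by linarith [hid i, hN i, hD i, heq i hi]) (hN i)
    have h' := (Finset.sum_eq_zero_iff_of_nonneg (hterm i)).mp h u (Finset.mem_univ u)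
    rw [if_pos ⟨hu, hiu⟩] at h'
    linarith
  -- Otherwise `a`, its neighbours (in `A`) and its non-neighbours all have degree `k`. The edge
  -- count of a `k`-regular `H` then gives `n = k + 1`, so `a` is dominating after all.
  obtain ⟨i, hi, hid'⟩ : ∃ i ∈ A, (H.degree i : ℝ) = Fintype.card V - 1 := by
    by_contra! hcon
    have hreg : ∀ u, (H.degree u : ℝ) = k := by
      intro u
      by_cases hua : u = a
      · exact hua ▸ (hdeg a ha).resolve_right (hcon a ha)
      by_cases hu : H.Adj a u
      · have hu' := (hA a ha).2 u (hadj a ha u hu)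
        exact (hdeg u hu').resolve_right (hcon u hu')
      · exact hnon a ha u hua hu
    have h1 := hT
    simp only [hreg, Finset.sum_const, Finset.card_univ, nsmul_eq_mul] at h1
    have h2 : (k : ℝ) * (Fintype.card V - 1 - k) = 0 := by linear_combination -h1
    rcases mul_eq_zero.mp h2 with h | h
    · exact hkpos.ne' (by exact_mod_cast h)
    · exact hcon a ha (by rw [hreg]; linarith)
  have hall : ∀ u, u ∈ A := by
    intro u
    by_cases hui : u = i
    · exact hui ▸ hi
    · exact (hA i hi).2 u (hadj i hi u (SimpleGraph.adj_of_degree_eq hid' hui))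
  have hGeq : G = H := le_antisymm hGH fun u v huv => hadj u (hall u) v huv
  subst hGeq
  exact hS (SimpleGraph.isCompleteSplit_of_degree hk hT fun v => hdeg v (hall v))

/-! ### The lower bound for `S_{n,k}` and the conclusion -/

theorem le_qIndex_of_mulVec {V : Type*} [Fintype V] {G : SimpleGraph V} {r : ℝ} {y : V → ℝ}
    (hy : y ≠ 0) (h : ∀ v, (G.signlessLaplacian.mulVec y) v = r * y v) : r ≤ G.qIndex := by
  classical
  obtain ⟨v, -⟩ := Function.ne_iff.mp hy
  have : Nonempty V := ⟨v⟩
  refine G.isGreatest_qIndex.2 (Module.End.hasEigenvalue_of_hasEigenvector (x := y) ?_)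
  rw [Module.End.hasEigenvector_iff, Module.End.mem_eigenspace_iff, Matrix.toLin'_apply]
  exact ⟨funext fun v => by simpa using h v, hy⟩

theorem SimpleGraph.exists_eigenvector_qIndex {V : Type*} [Fintype V] [Nonempty V]
    (G : SimpleGraph V) :
    ∃ y : V → ℝ, y ≠ 0 ∧ ∀ v, (G.signlessLaplacian.mulVec y) v = G.qIndex * y v := by
  classical
  obtain ⟨y, hy⟩ := Module.End.HasEigenvalue.exists_hasEigenvector G.isGreatest_qIndex.1
  rw [Module.End.hasEigenvector_iff, Module.End.mem_eigenspace_iff, Matrix.toLin'_apply] at hy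
  exact ⟨y, hy.2, fun v => by rw [hy.1]; rfl⟩

/-- `h1` and `h2` are the eigenvalue equations for the vector equal to `a` on the clique and `c` on
the independent set; the second is void when `n = k`. -/
theorem le_qIndex_graphS {n k : ℕ} (hk : 1 ≤ k) (hkn : k ≤ n) {r a c : ℝ} (hac : a ≠ 0)
    (h1 : ((n : ℝ) - 1 + (k - 1)) * a + (n - k) * c = r * a)
    (h2 : k < n → k * c + k * a = r * c) : r ≤ (graphS n k).qIndex := by
  classical
  refine le_qIndex_of_mulVec (y := Sum.elim (fun _ => a) (fun _ => c)) ?_ ?_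
  · exact Function.ne_iff.mpr ⟨Sum.inl ⟨0, hk⟩, by simpa using hac⟩
  rintro (i | j)
  · rw [SimpleGraph.signlessLaplacian_mulVec, Fintype.sum_sum_type]
    have hL : (∑ x : Fin k, if i = x then (0 : ℝ) else a + a) = (k - 1) * (a + a) := by
      have : ∀ x : Fin k, (if i = x then (0 : ℝ) else a + a) =
          (a + a) - if i = x then (a + a) else 0 := fun x => by split_ifs <;> ring
      simp_rw [this]
      rw [Finset.sum_sub_distrib]
      simp
      ring
    simp [graphS, SimpleGraph.joinGraph, hL, Nat.cast_sub hkn]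
    linear_combination h1
  · have hlt : k < n := by have := j.2; omega
    rw [SimpleGraph.signlessLaplacian_mulVec, Fintype.sum_sum_type]
    simp [graphS, SimpleGraph.joinGraph]
    linear_combination h2 hlt

theorem theorem2 {V : Type*} [Fintype V] (G : SimpleGraph V) (n k : ℕ)
    (hn : Fintype.card V = n) (hk : k ≤ n) (hG : G.IsDegenerate k)
    (hS : ¬ Nonempty (G ≃g graphS n k)) :
    G.qIndex < (graphS n k).qIndex := by
  classical
  have hF := hG.isFinsetDegenerate
  have hsplit : ¬ G.IsCompleteSplit k := fun h => hS (h.nonempty_iso hn)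
  rcases Nat.eq_zero_or_pos k with rfl | hkpos
  -- A `0`-degenerate graph has no edges, so it is complete split with empty clique.
  · refine absurd ⟨∅, rfl, fun u v => ⟨fun huv => ?_, fun h => by simp at h⟩⟩ hsplit
    obtain ⟨x, hx, hd⟩ := hF {u, v} ⟨u, by simp⟩
    rw [Nat.le_zero, Finset.card_eq_zero, Finset.filter_eq_empty_iff] at hd
    rw [Finset.mem_insert, Finset.mem_singleton] at hx
    rcases hx with rfl | rfl
    · exact absurd huv (hd (by simp))
    · exact absurd huv.symm (hd (by simp))
  have : Nonempty V := Fintype.card_pos_iff.mp (by omega)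
  obtain ⟨y, hy, hq⟩ := G.exists_eigenvector_qIndex
  have hkR : (1 : ℝ) ≤ k := by exact_mod_cast hkpos
  rcases hk.lt_or_eq with hlt | rfl
  · have hltR : (k : ℝ) + 1 ≤ n := by exact_mod_cast hlt
    set b : ℝ := n + 2 * k - 2 with hb
    set D : ℝ := b ^ 2 - 8 * k * (k - 1) with hD
    have hDpos : 0 < D := by rw [hD, hb]; nlinarith
    have hsq := Real.sq_sqrt hDpos.le
    have hsnn := Real.sqrt_pos.mpr hDpos
    set t := Real.sqrt D with ht
    -- At `2k` the quadratic equals `2k(k+1-n) ≤ 0`, so `2k` lies between the roots; if `n = k + 1`,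
    -- they are `2k` and `k - 1`.
    have hs : (b - t) / 2 < 2 * k := by
      have : b - 4 * k < t := by
        by_contra! hcon
        rw [hb] at hcon
        have : t ^ 2 ≤ ((n : ℝ) + 2 * k - 2 - 4 * k) ^ 2 := pow_le_pow_left₀ hsnn.le hcon 2
        rw [hsq, hD, hb] at this
        nlinarith
      linarith
    have hprod : (b + t) / 2 * ((b - t) / 2) = 2 * k * (k - 1) := by
      rw [show (b + t) / 2 * ((b - t) / 2) = (b ^ 2 - t ^ 2) / 4 by ring, hsq, hD]; ring
    have hup := hF.eigenvalue_lt hkpos (by omega) hsplit (r := (b + t) / 2) (s := (b - t) / 2)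
      (by rw [hn, ← hb]; ring) hprod hs hy hq
    refine hup.trans_le (le_qIndex_graphS hkpos hk (a := (b + t) / 2 - k) (c := k) ?_ ?_ ?_)
    · have : 0 < (b + t) / 2 - k := by rw [hb]; linarith
      exact this.ne'
    · rw [show (b + t) / 2 * ((b + t) / 2 - k) =
        (b + t) / 2 * (b - k) - (b + t) / 2 * ((b - t) / 2) by ring, hprod, hb]
      ring
    · intro _; ring
  -- For `n = k` the extremal graph is complete, which is also the split graph with clique size `k -
  -- 1`. The bound is therefore applied with `k - 1`, where the roots are `2(k-1)` and `k - 2`.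
  · have hsplit' : ¬ G.IsCompleteSplit (k - 1) := by
      rintro ⟨K, hK, hadj⟩
      refine hsplit (.of_forall_adj hn.ge (by omega) fun u v huv => ?_)
      rw [hadj]
      refine ⟨huv, ?_⟩
      by_contra! hcon
      have h1 : ({u, v} : Finset V) ⊆ Kᶜ := by
        intro a ha
        rw [Finset.mem_insert, Finset.mem_singleton] at ha
        rcases ha with rfl | rfl
        · simpa using hcon.1
        · simpa using hcon.2
      have h2 := Finset.card_le_card h1
      rw [Finset.card_pair huv, Finset.card_compl, hK] at h2
      omega
    have hk2 : 2 ≤ k := by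
      by_contra! hcon
      refine hsplit (.of_forall_adj hn.ge (by omega) fun u v huv => absurd ?_ huv)
      have : Subsingleton V := Fintype.card_le_one_iff_subsingleton.mp (by omega)
      exact Subsingleton.elim u v
    have hk2R : (2 : ℝ) ≤ k := by exact_mod_cast hk2
    have hF' : G.IsFinsetDegenerate (k - 1) := by
      intro S ⟨v, hv⟩
      refine ⟨v, hv, ?_⟩
      have hsub : S.filter (G.Adj v) ⊆ Finset.univ.erase v := fun u hu =>
        Finset.mem_erase.mpr ⟨(Finset.mem_filter.mp hu).2.ne', Finset.mem_univ u⟩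
      have h := Finset.card_le_card hsub
      rwa [Finset.card_erase_of_mem (Finset.mem_univ v), Finset.card_univ, hn] at h
    have hcast : ((k - 1 : ℕ) : ℝ) = k - 1 := by rw [Nat.cast_sub hkpos, Nat.cast_one]
    have hup := hF'.eigenvalue_lt (by omega) (by omega) hsplit' (r := 2 * (k - 1)) (s := k - 2)
      (by rw [hn, hcast]; ring) (by rw [hcast]; ring) (by rw [hcast]; linarith) hy hq
    refine hup.trans_le (le_qIndex_graphS hkpos hk (a := 1) (c := 0) one_ne_zero ?_ ?_)
    · ring
    · intro h; exact absurd h (lt_irrefl _)
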